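/- For every constant $c>0$ there is a constant $\delta>0$, depending only on $c$, such that the following holds. Let $w$ and $N$ be integers with $0<w<2w\le N$ and $N\ge 2^{cw}$. Let $R_x=[2w,N]\times[0,w]$ and $R_y=[0,w]\times[2w,N]$ be rectangles in the plane, and let $L=R_x\cup R_y$. Let $p(x,y)$ be a real polynomial of (total) degree $d$ such that 1. $p(2w,2w)\ge 2$, and 2. $0\le p(x,y)\le 1$ for all $(x,y)\in L\cap\mathbb{Z}^2$. Then $d\ge \delta w$. (In asymptotic notation: if $N=2^{\Omega(w)}$, then $d=\Omega(w)$.) -/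

import Mathlib

/-- The rectangle `R_x = [2w, N] × [0, w]` in the plane. -/
def rectX (w N : ℝ) : Set (ℝ × ℝ) := Set.Icc (2 * w) N ×ˢ Set.Icc 0 w

/-- The rectangle `R_y = [0, w] × [2w, N]` in the plane. -/
def rectY (w N : ℝ) : Set (ℝ × ℝ) := Set.Icc 0 w ×ˢ Set.Icc (2 * w) N

/-- The L-shaped region `L = R_x ∪ R_y`. -/
def regionL (w N : ℝ) : Set (ℝ × ℝ) := rectX w N ∪ rectY w N

/-- The value `p(x, y)` of a real bivariate polynomial. -/
noncomputable def evalXY (p : MvPolynomial (Fin 2) ℝ) (x y : ℝ) : ℝ :=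
  MvPolynomial.eval ![x, y] p

/-!
Suppose `d ≤ w`, where `d` is the degree of `p`. Interpolating at `d + 1` consecutive integers,
first in one variable and then in the other, shows that `|p| ≤ exp (4 * d)` on all of `L`. The
hyperbola `x * y = (2 * w) ^ 2` passes through the corner `(2w, 2w)`, and its points with
`5w ≤ x + y ≤ N` lie in `L`. On it, `p(x, y) + p(y, x)` is a polynomial `Q` of degree at most `d`
in `x + y`, with `Q(4w) ≥ 4`, `Q(5w) ≤ 2` and `|Q| ≤ 2 * exp (4 * d)` on `[5w, N]`. If `N` exceeded
`8 * w * exp (6 * d)`, this interval would be so much longer than `w` that `Q` could not change by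
`2` between `4w` and `5w`. Hence `2 ^ (c * w) ≤ N ≤ 8 * w * exp (6 * d)`, so `d` is at least
proportional to `w`.
-/

open Finset Polynomial fwdDiff

/-- Newton's forward difference formula: `(descPochhammer K k).eval u / k!` is the generalised
binomial coefficient `u` choose `k`. -/
theorem eval_add_mul_eq_sum_fwdDiff {K : Type*} [Field K] [CharZero K] {g : K[X]} {d : ℕ}
    (hg : g.natDegree ≤ d) (y h u : K) :
    g.eval (y + u * h) = ∑ k ∈ range (d + 1),
      (descPochhammer K k).eval u / k.factorial * Δ_[h] ^[k] g.eval y := by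
  set P : K[X] :=
    ∑ k ∈ range (d + 1), C (Δ_[h] ^[k] g.eval y / k.factorial) * descPochhammer K k with hP
  have eval_P (v : K) : P.eval v = ∑ k ∈ range (d + 1),
      (descPochhammer K k).eval v / k.factorial * Δ_[h] ^[k] g.eval y := by
    rw [hP, eval_finsetSum]
    refine sum_congr rfl fun k _ => ?_
    rw [eval_mul, eval_C]
    ring
  have degree_P : P.natDegree ≤ d := by
    refine natDegree_sum_le_of_forall_le _ _ fun k hk => (natDegree_C_mul_le _ _).trans ?_
    rw [descPochhammer_natDegree]
    exact mem_range_succ_iff.mp hk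
  have degree_comp : (g.comp (C h * X + C y)).natDegree ≤ d :=
    natDegree_comp_le.trans <| (Nat.mul_le_mul hg natDegree_linear_le).trans_eq (mul_one d)
  have eval_natCast (n : ℕ) (hn : n ≤ d) :
      (g.comp (C h * X + C y)).eval (n : K) = P.eval (n : K) := by
    have term_eq (k : ℕ) : n.choose k • Δ_[h] ^[k] g.eval y =
        (descPochhammer K k).eval (n : K) / k.factorial * Δ_[h] ^[k] g.eval y := by
      rw [descPochhammer_eval_eq_descFactorial, Nat.descFactorial_eq_factorial_mul_choose,
        Nat.cast_mul, mul_div_cancel_left₀ _ (Nat.cast_ne_zero.mpr k.factorial_ne_zero),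
        nsmul_eq_mul]
    calc (g.comp (C h * X + C y)).eval (n : K) = g.eval (y + n • h) := by
          simp only [eval_comp, eval_add, eval_mul, eval_C, eval_X, nsmul_eq_mul]
          ring_nf
      _ = ∑ k ∈ range (n + 1), n.choose k • Δ_[h] ^[k] g.eval y :=
          shift_eq_sum_fwdDiff_iter h g.eval n y
      _ = ∑ k ∈ range (d + 1), n.choose k • Δ_[h] ^[k] g.eval y := by
          refine sum_subset (range_subset_range.mpr (Nat.succ_le_succ hn)) fun k _ hk => ?_
          rw [Nat.choose_eq_zero_of_lt (by simpa using hk), zero_smul]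
      _ = P.eval (n : K) := by simp only [eval_P, term_eq]
  have comp_eq : g.comp (C h * X + C y) = P := by
    have degree_lt {q : K[X]} (hq : q.natDegree ≤ d) : q.degree < #(range (d + 1)) := by
      rw [card_range]
      exact (degree_le_of_natDegree_le hq).trans_lt (by exact_mod_cast d.lt_succ_self)
    exact eq_of_degrees_lt_of_eval_index_eq (v := fun n : ℕ => (n : K)) (range (d + 1))
      Nat.cast_injective.injOn (degree_lt degree_comp) (degree_lt degree_P)
      fun n hn => eval_natCast n (mem_range_succ_iff.mp hn)
  rw [← eval_P, ← comp_eq]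
  simp only [eval_comp, eval_add, eval_mul, eval_C, eval_X]
  ring_nf

theorem norm_fwdDiff_iter_le {M G : Type*} [AddCommMonoid M] [SeminormedAddCommGroup G]
    {f : M → G} {y h : M} {n : ℕ} {B : ℝ} (hB : ∀ j ≤ n, ‖f (y + j • h)‖ ≤ B) :
    ‖Δ_[h] ^[n] f y‖ ≤ 2 ^ n * B := by
  induction n generalizing y with
  | zero => simpa using hB 0 le_rfl
  | succ n ih =>
    have hy : ‖Δ_[h] ^[n] f y‖ ≤ 2 ^ n * B := ih fun j hj => hB j (hj.trans n.le_succ)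
    have hyh : ‖Δ_[h] ^[n] f (y + h)‖ ≤ 2 ^ n * B := ih fun j hj => by
      rw [add_assoc, ← succ_nsmul']
      exact hB (j + 1) (Nat.succ_le_succ hj)
    rw [Function.iterate_succ_apply', fwdDiff, pow_succ]
    linarith [norm_sub_le (Δ_[h] ^[n] f (y + h)) (Δ_[h] ^[n] f y)]

theorem abs_descPochhammer_eval_le_pow {k : ℕ} {A u : ℝ} (hk : k ≤ A) (hu : u ∈ Set.Icc 0 A) :
    |(descPochhammer ℝ k).eval u| ≤ A ^ k := by
  rw [descPochhammer_eval_eq_prod_range, abs_prod]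
  calc ∏ j ∈ range k, |u - j| ≤ ∏ _j ∈ range k, A := by
        refine prod_le_prod (fun _ _ => abs_nonneg _) fun j hj => ?_
        have hjA : (j : ℝ) ≤ A := hk.trans' <| Nat.cast_le.mpr (mem_range.mp hj).le
        rw [abs_le]
        constructor <;> linarith [hu.1, hu.2, (Nat.cast_nonneg j : (0 : ℝ) ≤ j)]
    _ = A ^ k := by rw [prod_const, card_range]

theorem abs_descPochhammer_succ_eval_neg_le {u : ℝ} (hu : u ∈ Set.Icc 0 1) (k : ℕ) :
    |(descPochhammer ℝ (k + 1)).eval (-u)| ≤ u * (k + 1).factorial := by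
  induction k with
  | zero => simp [abs_of_nonneg hu.1]
  | succ k ih =>
    rw [descPochhammer_succ_eval, abs_mul, Nat.factorial_succ (k + 1)]
    have hfactor : |-u - (k + 1 : ℕ)| ≤ (k + 1 + 1 : ℕ) := by
      push_cast
      rw [abs_le]
      constructor <;> linarith [hu.1, hu.2, (Nat.cast_nonneg k : (0 : ℝ) ≤ k)]
    calc _ ≤ u * (k + 1).factorial * (k + 1 + 1 : ℕ) :=
          mul_le_mul ih hfactor (abs_nonneg _) (mul_nonneg hu.1 (Nat.cast_nonneg _))
      _ = _ := by push_cast; ring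

theorem abs_eval_add_mul_le_exp {g : ℝ[X]} {d : ℕ} (hg : g.natDegree ≤ d) {y h B u : ℝ}
    (hB : ∀ j : ℕ, j ≤ d → |g.eval (y + j * h)| ≤ B) (hu : u ∈ Set.Icc 0 (d : ℝ)) :
    |g.eval (y + u * h)| ≤ B * Real.exp (2 * d) := by
  have hB0 : 0 ≤ B := (abs_nonneg _).trans (hB 0 d.zero_le)
  rw [eval_add_mul_eq_sum_fwdDiff hg]
  calc _ ≤ ∑ k ∈ range (d + 1), B * ((2 * d) ^ k / k.factorial) := by
        refine (abs_sum_le_sum_abs _ _).trans (sum_le_sum fun k hk => ?_)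
        have hkd : k ≤ d := mem_range_succ_iff.mp hk
        have hbinom : |(descPochhammer ℝ k).eval u| ≤ d ^ k :=
          abs_descPochhammer_eval_le_pow (Nat.cast_le.mpr hkd) hu
        have hdiff : |Δ_[h] ^[k] g.eval y| ≤ 2 ^ k * B :=
          norm_fwdDiff_iter_le (f := g.eval) fun j hj => by simpa using hB j (hj.trans hkd)
        rw [abs_mul, abs_div, Nat.abs_cast]
        calc _ ≤ d ^ k / k.factorial * (2 ^ k * B) := by gcongr
          _ = B * ((2 * d) ^ k / k.factorial) := by rw [mul_pow]; ring
    _ ≤ B * Real.exp (2 * d) := by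
        rw [← mul_sum]
        exact mul_le_mul_of_nonneg_left (Real.sum_le_exp_of_nonneg (by positivity) _) hB0

theorem abs_eval_sub_mul_sub_eval_le {g : ℝ[X]} {d : ℕ} (hg : g.natDegree ≤ d) {y h B u : ℝ}
    (hB : ∀ j : ℕ, j ≤ d → |g.eval (y + j * h)| ≤ B) (hu : u ∈ Set.Icc 0 1) :
    |g.eval (y - u * h) - g.eval y| ≤ u * (2 ^ (d + 1) * B) := by
  have hB0 : 0 ≤ B := (abs_nonneg _).trans (hB 0 d.zero_le)
  have newton : g.eval (y - u * h) - g.eval y = ∑ k ∈ range d,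
      (descPochhammer ℝ (k + 1)).eval (-u) / (k + 1).factorial * Δ_[h] ^[k + 1] g.eval y := by
    rw [sub_eq_add_neg y, ← neg_mul, eval_add_mul_eq_sum_fwdDiff hg, sum_range_succ']
    simp
  have geom : ∑ k ∈ range d, (2 : ℝ) ^ (k + 1) ≤ 2 ^ (d + 1) := by
    simp_rw [pow_succ _ (_ : ℕ), ← sum_mul]
    gcongr
    rw [geom_sum_eq (by norm_num)]
    linarith
  calc |g.eval (y - u * h) - g.eval y| ≤ ∑ k ∈ range d, u * (2 ^ (k + 1) * B) := by
        rw [newton]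
        refine (abs_sum_le_sum_abs _ _).trans (sum_le_sum fun k hk => ?_)
        have hkd : k + 1 ≤ d := mem_range.mp hk
        have hdiff : |Δ_[h] ^[k + 1] g.eval y| ≤ 2 ^ (k + 1) * B :=
          norm_fwdDiff_iter_le (f := g.eval) fun j hj => by simpa using hB j (hj.trans hkd)
        have hbinom :
            |(descPochhammer ℝ (k + 1)).eval (-u)| / ((k + 1).factorial : ℝ) ≤ u :=
          (div_le_iff₀ (by positivity)).mpr (abs_descPochhammer_succ_eval_neg_le hu k)
        rw [abs_mul, abs_div, Nat.abs_cast]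
        exact mul_le_mul hbinom hdiff (abs_nonneg _) hu.1
    _ = u * ((∑ k ∈ range d, (2 : ℝ) ^ (k + 1)) * B) := by rw [← mul_sum, ← sum_mul]
    _ ≤ u * (2 ^ (d + 1) * B) := by have := hu.1; gcongr

theorem abs_eval_sub_sub_eval_le {g : ℝ[X]} {d : ℕ} (hg : g.natDegree ≤ d) {a b v h B : ℝ}
    (hB : ∀ s ∈ Set.Icc a b, |g.eval s| ≤ B) (hh : 0 < h) (hab : a + d * h ≤ b)
    (hv : v ∈ Set.Icc 0 h) : |g.eval (a - v) - g.eval a| ≤ v / h * (2 ^ (d + 1) * B) := by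
  have hgrid (j : ℕ) (hj : j ≤ d) : |g.eval (a + j * h)| ≤ B := by
    refine hB _ ⟨le_add_of_nonneg_right (by positivity), hab.trans' ?_⟩
    gcongr
  have := abs_eval_sub_mul_sub_eval_le hg hgrid (u := v / h)
    ⟨div_nonneg hv.1 hh.le, div_le_one_of_le₀ hv.2 hh.le⟩
  rwa [div_mul_cancel₀ _ hh.ne'] at this

theorem abs_eval_le_exp_of_int_bound {f : ℝ[X]} {d : ℕ} (hf : f.natDegree ≤ d) {a b : ℤ}
    (hab : a + d ≤ b) {B : ℝ} (hB : ∀ n ∈ Set.Icc a b, |f.eval (n : ℝ)| ≤ B) {x : ℝ}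
    (hx : x ∈ Set.Icc (a : ℝ) b) : |f.eval x| ≤ B * Real.exp (2 * d) := by
  obtain rfl | hd := d.eq_zero_or_pos
  · obtain ⟨c, rfl⟩ := natDegree_eq_zero.mp (Nat.le_zero.mp hf)
    simpa using hB a ⟨le_rfl, by simpa using hab⟩
  obtain ⟨n, han, hnb, hnx⟩ :
      ∃ n : ℤ, a ≤ n ∧ n + d ≤ b ∧ x - n ∈ Set.Icc 0 (d : ℝ) := by
    have hfloor : a ≤ ⌊x⌋ := Int.le_floor.mpr hx.1
    have hd1 : (1 : ℝ) ≤ d := by exact_mod_cast hd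
    obtain hxb | hbx := le_total ⌊x⌋ (b - d)
    · exact ⟨⌊x⌋, hfloor, by lia, by linarith [Int.floor_le x],
        by linarith [Int.lt_floor_add_one x]⟩
    · refine ⟨b - d, by lia, by lia, ?_, ?_⟩
      · linarith [(Int.cast_le (R := ℝ)).mpr hbx, Int.floor_le x]
      · push_cast
        linarith [hx.2]
  have hnodes (j : ℕ) (hj : j ≤ d) : |f.eval (n + j * 1 : ℝ)| ≤ B := by
    have := hB (n + j) ⟨by lia, by lia⟩
    push_cast at this
    rwa [mul_one]
  simpa using abs_eval_add_mul_le_exp hf hnodes hnx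

theorem eval_aeval_eq_eval {R σ : Type*} [CommSemiring R] (p : MvPolynomial σ R) (f : σ → R[X])
    (t : R) : (MvPolynomial.aeval f p).eval t = MvPolynomial.eval (fun i => (f i).eval t) p := by
  rw [MvPolynomial.aeval_def, MvPolynomial.polynomial_eval_eval₂, MvPolynomial.eval,
    MvPolynomial.coe_eval₂Hom]
  congr 1
  ext
  simp

theorem abs_mvPolynomial_eval_le_exp_of_int_bound {p : MvPolynomial (Fin 2) ℝ}
    {a b a' b' : ℤ} (hab : a + p.totalDegree ≤ b) (hab' : a' + p.totalDegree ≤ b') {B : ℝ}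
    (hB : ∀ m ∈ Set.Icc a b, ∀ n ∈ Set.Icc a' b', |MvPolynomial.eval ![(m : ℝ), (n : ℝ)] p| ≤ B)
    {x y : ℝ} (hx : x ∈ Set.Icc (a : ℝ) b) (hy : y ∈ Set.Icc (a' : ℝ) b') :
    |MvPolynomial.eval ![x, y] p| ≤ B * Real.exp (4 * p.totalDegree) := by
  have slice_degree (q r : ℝ[X]) (hq : q.natDegree ≤ 1) (hr : r.natDegree ≤ 1) :
      (MvPolynomial.aeval ![q, r] p).natDegree ≤ p.totalDegree := by
    simpa using MvPolynomial.aeval_natDegree_le p le_rfl ![q, r] (n := 1)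
      fun i => by fin_cases i <;> assumption
  have slice_eval (q r : ℝ[X]) (t : ℝ) : (MvPolynomial.aeval ![q, r] p).eval t =
      MvPolynomial.eval ![q.eval t, r.eval t] p := by
    rw [eval_aeval_eq_eval]
    congr 2
    ext i
    fin_cases i <;> rfl
  have horizontal (n : ℤ) (hn : n ∈ Set.Icc a' b') :
      |MvPolynomial.eval ![x, (n : ℝ)] p| ≤ B * Real.exp (2 * p.totalDegree) := by
    have := abs_eval_le_exp_of_int_bound
      (slice_degree X (C (n : ℝ)) natDegree_X_le (by simp)) hab
      (fun m hm => by simpa [slice_eval] using hB m hm n hn) hx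
    simpa only [slice_eval, eval_X, eval_C] using this
  have vertical : |MvPolynomial.eval ![x, y] p| ≤
      B * Real.exp (2 * p.totalDegree) * Real.exp (2 * p.totalDegree) := by
    have := abs_eval_le_exp_of_int_bound
      (slice_degree (C x) X (by simp) natDegree_X_le) hab'
      (fun n hn => by simpa [slice_eval] using horizontal n hn) hy
    simpa only [slice_eval, eval_X, eval_C] using this
  rwa [mul_assoc, ← Real.exp_add, ← add_mul, show (2 + 2 : ℝ) = 4 by norm_num] at vertical

section HyperbolaSymmetrization

variable {R : Type*} [CommRing R]

theorem natDegree_dickson_le (k : ℕ) (a : R) (n : ℕ) : (dickson k a n).natDegree ≤ n := by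
  induction n using Nat.twoStepInduction with
  | zero => exact (natDegree_sub_le _ _).trans (by simp)
  | one => exact natDegree_X_le
  | more n ih₀ ih₁ =>
    rw [dickson_add_two]
    refine (natDegree_sub_le_of_le (natDegree_mul_le_of_le natDegree_X_le ih₁)
      ((natDegree_C_mul_le _ _).trans ih₀)).trans ?_
    lia

/-- Mathlib has the case `x * y = 1`, as `Polynomial.dickson_one_one_eval_add_inv`. -/
theorem dickson_one_mul_eval_add (x y : R) (n : ℕ) :
    (dickson 1 (x * y) n).eval (x + y) = x ^ n + y ^ n := by
  induction n using Nat.twoStepInduction with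
  | zero => norm_num
  | one => simp
  | more n ih₀ ih₁ =>
    simp only [dickson_add_two, eval_sub, eval_mul, eval_X, eval_C, ih₀, ih₁]
    ring

/-- The restriction of `p(x, y) + p(y, x)` to the hyperbola `x * y = k`, as a polynomial in `x + y`:
there, `x ^ a * y ^ b + y ^ a * x ^ b` is `k ^ min a b` times the power sum `x ^ n + y ^ n` with
`n = |a - b|`, which is a Dickson polynomial in `x + y`. -/
noncomputable def hyperbolaSymm (p : MvPolynomial (Fin 2) R) (k : R) : R[X] :=
  ∑ m ∈ p.support, C (p.coeff m) *
    (C (k ^ min (m 0) (m 1)) * dickson 1 k (max (m 0) (m 1) - min (m 0) (m 1)))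

theorem natDegree_hyperbolaSymm_le (p : MvPolynomial (Fin 2) R) (k : R) :
    (hyperbolaSymm p k).natDegree ≤ p.totalDegree := by
  refine natDegree_sum_le_of_forall_le _ _ fun m hm => ?_
  have degree_monomial : m 0 + m 1 ≤ p.totalDegree := by
    have := MvPolynomial.le_totalDegree hm
    rwa [Finsupp.sum_fintype _ _ fun _ => rfl, Fin.sum_univ_two] at this
  calc _ ≤ max (m 0) (m 1) - min (m 0) (m 1) :=
        (natDegree_C_mul_le _ _).trans <| (natDegree_C_mul_le _ _).trans (natDegree_dickson_le ..)
    _ ≤ p.totalDegree := by lia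

theorem hyperbolaSymm_eval (p : MvPolynomial (Fin 2) R) {x y k s : R} (hk : x * y = k)
    (hs : x + y = s) : (hyperbolaSymm p k).eval s =
      MvPolynomial.eval ![x, y] p + MvPolynomial.eval ![y, x] p := by
  subst hk hs
  have eval_monomial (a b : ℕ) : (x * y) ^ min a b *
      (x ^ (max a b - min a b) + y ^ (max a b - min a b)) = x ^ a * y ^ b + y ^ a * x ^ b := by
    obtain hab | hba := le_total a b
    · obtain ⟨n, rfl⟩ := Nat.exists_eq_add_of_le hab
      rw [min_eq_left hab, max_eq_right hab, Nat.add_sub_cancel_left]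
      ring
    · obtain ⟨n, rfl⟩ := Nat.exists_eq_add_of_le hba
      rw [min_eq_right hba, max_eq_left hba, Nat.add_sub_cancel_left]
      ring
  rw [hyperbolaSymm, eval_finsetSum, MvPolynomial.eval_eq', MvPolynomial.eval_eq',
    ← sum_add_distrib]
  refine sum_congr rfl fun m _ => ?_
  simp only [eval_mul, eval_C, dickson_one_mul_eval_add, eval_monomial, Fin.prod_univ_two,
    Matrix.cons_val_zero, Matrix.cons_val_one]
  ring

end HyperbolaSymmetrization

theorem intCast_mem_rectX {w N m n : ℤ} :
    ((m : ℝ), (n : ℝ)) ∈ rectX w N ↔ m ∈ Set.Icc (2 * w) N ∧ n ∈ Set.Icc 0 w := by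
  simp only [rectX, Set.mem_prod, Set.mem_Icc]
  norm_cast

theorem swap_mem_rectY {w N x y : ℝ} : (y, x) ∈ rectY w N ↔ (x, y) ∈ rectX w N := by
  simp only [rectX, rectY, Set.mem_prod, and_comm]

theorem abs_evalXY_le_exp_of_mem_regionL {w N : ℤ} {p : MvPolynomial (Fin 2) ℝ}
    (hdw : p.totalDegree ≤ w) (hdN : 2 * w + p.totalDegree ≤ N)
    (hL : ∀ x y : ℤ, ((x : ℝ), (y : ℝ)) ∈ regionL w N → |evalXY p x y| ≤ 1)
    {x y : ℝ} (hxy : (x, y) ∈ regionL w N) :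
    |evalXY p x y| ≤ Real.exp (4 * p.totalDegree) := by
  rw [← one_mul (Real.exp _)]
  have hdw' : 0 + p.totalDegree ≤ w := by rwa [zero_add]
  obtain ⟨hx, hy⟩ | ⟨hx, hy⟩ := hxy
  · refine abs_mvPolynomial_eval_le_exp_of_int_bound hdN hdw' (fun m hm n hn => ?_)
      (by exact_mod_cast hx) (by exact_mod_cast hy)
    exact hL m n <| .inl <| intCast_mem_rectX.mpr ⟨hm, hn⟩
  · refine abs_mvPolynomial_eval_le_exp_of_int_bound hdw' hdN (fun m hm n hn => ?_)
      (by exact_mod_cast hx) (by exact_mod_cast hy)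
    exact hL m n <| .inr <| swap_mem_rectY.mpr <| intCast_mem_rectX.mpr ⟨hn, hm⟩

theorem exists_mem_rectX_mul_eq_add_eq {w N s : ℝ} (hw : 0 ≤ w) (hs : s ∈ Set.Icc (5 * w) N) :
    ∃ x y, (x, y) ∈ rectX w N ∧ x * y = 2 * w * (2 * w) ∧ x + y = s := by
  obtain ⟨hws, hsN⟩ := hs
  have hdisc : 3 * w ≤ √(s ^ 2 - 16 * w ^ 2) := Real.le_sqrt_of_sq_le (by nlinarith)
  have hsq : √(s ^ 2 - 16 * w ^ 2) ^ 2 = s ^ 2 - 16 * w ^ 2 := Real.sq_sqrt (by nlinarith)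
  set r := √(s ^ 2 - 16 * w ^ 2)
  have hrs : r ≤ s := by nlinarith
  refine ⟨(s + r) / 2, (s - r) / 2, ⟨⟨?_, ?_⟩, ?_, ?_⟩, ?_, ?_⟩ <;> nlinarith

theorem abs_hyperbolaSymm_eval_le {w N s B : ℝ} (hw : 0 ≤ w) {p : MvPolynomial (Fin 2) ℝ}
    (hB : ∀ x y, (x, y) ∈ regionL w N → |evalXY p x y| ≤ B) (hs : s ∈ Set.Icc (5 * w) N) :
    |(hyperbolaSymm p (2 * w * (2 * w))).eval s| ≤ 2 * B := by
  obtain ⟨x, y, hmem, hmul, hadd⟩ := exists_mem_rectX_mul_eq_add_eq hw hs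
  rw [hyperbolaSymm_eval p hmul hadd, two_mul]
  exact (abs_add_le _ _).trans <|
    add_le_add (hB x y (.inl hmem)) (hB y x (.inr (swap_mem_rectY.mpr hmem)))

theorem natCast_mul_two_pow_le_exp (d : ℕ) : (d : ℝ) * 2 ^ d ≤ Real.exp (2 * d) := by
  have hd : (d : ℝ) ≤ Real.exp d := by linarith [Real.add_one_le_exp (d : ℝ)]
  have hpow : (2 : ℝ) ^ d ≤ Real.exp d := by
    rw [← Real.exp_one_pow]
    gcongr
    linarith [Real.add_one_le_exp (1 : ℝ)]
  rw [two_mul, Real.exp_add]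
  gcongr

theorem two_le_hyperbolaSymm_eval_sub_eval {w N : ℤ} (hw : 0 ≤ w) (hwN : 4 * w ≤ N)
    {p : MvPolynomial (Fin 2) ℝ} (h2 : 2 ≤ evalXY p (2 * w) (2 * w))
    (hL : ∀ x y : ℤ, ((x : ℝ), (y : ℝ)) ∈ regionL w N → |evalXY p x y| ≤ 1) :
    2 ≤ (hyperbolaSymm p (2 * w * (2 * w) : ℝ)).eval (4 * w : ℝ) -
      (hyperbolaSymm p (2 * w * (2 * w) : ℝ)).eval (5 * w : ℝ) := by
  have corner : (hyperbolaSymm p (2 * w * (2 * w) : ℝ)).eval (4 * w : ℝ) =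
      evalXY p (2 * w) (2 * w) + evalXY p (2 * w) (2 * w) :=
    hyperbolaSymm_eval p rfl (by ring)
  have entry : (hyperbolaSymm p (2 * w * (2 * w) : ℝ)).eval (5 * w : ℝ) =
      evalXY p (4 * w) w + evalXY p w (4 * w) :=
    hyperbolaSymm_eval p (by ring) (by ring)
  have hmem : (((4 * w : ℤ) : ℝ), (w : ℝ)) ∈ rectX w N :=
    intCast_mem_rectX.mpr ⟨⟨by lia, hwN⟩, hw, le_rfl⟩
  have hX := le_of_abs_le (hL (4 * w) w (.inl hmem))
  have hY := le_of_abs_le (hL w (4 * w) (.inr (swap_mem_rectY.mpr hmem)))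
  push_cast at hX hY
  linarith

theorem abs_hyperbolaSymm_eval_sub_eval_le {w N : ℤ} (hw : 0 < w) {p : MvPolynomial (Fin 2) ℝ}
    (hdw : p.totalDegree ≤ w) (hN : 8 * w * Real.exp (6 * p.totalDegree) ≤ N)
    (hL : ∀ x y : ℤ, ((x : ℝ), (y : ℝ)) ∈ regionL w N → |evalXY p x y| ≤ 1) :
    |(hyperbolaSymm p (2 * w * (2 * w) : ℝ)).eval (4 * w : ℝ) -
      (hyperbolaSymm p (2 * w * (2 * w) : ℝ)).eval (5 * w : ℝ)| ≤ 4 / 3 := by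
  set d := p.totalDegree
  have hw0 : (0 : ℝ) < w := Int.cast_pos.mpr hw
  have hwexp : (w : ℝ) ≤ w * Real.exp (6 * d) :=
    le_mul_of_one_le_right hw0.le (Real.one_le_exp (by positivity))
  have hwN : 8 * w ≤ N := by exact_mod_cast (by linarith : (8 * w : ℝ) ≤ N)
  have interval_bound : ∀ s ∈ Set.Icc (5 * w : ℝ) N,
      |(hyperbolaSymm p (2 * w * (2 * w) : ℝ)).eval s| ≤ 2 * Real.exp (4 * d) :=
    fun s => abs_hyperbolaSymm_eval_le hw0.le
      fun x y => abs_evalXY_le_exp_of_mem_regionL hdw (by lia) hL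
  -- With this grid step the bound on the change of the symmetrization is `4 / 3`.
  set h : ℝ := 3 * 2 ^ d * Real.exp (4 * d) * w with hh
  have hwh : w ≤ h := by
    have := one_le_mul_of_one_le_of_one_le (one_le_pow₀ one_le_two : (1 : ℝ) ≤ 2 ^ d)
      (Real.one_le_exp (by positivity : (0 : ℝ) ≤ 4 * d))
    nlinarith
  have grid_le : 5 * w + d * h ≤ N := by
    have hexp : d * 2 ^ d * Real.exp (4 * d) ≤ Real.exp (6 * d) := by
      rw [show (6 * d : ℝ) = 2 * d + 4 * d by ring, Real.exp_add]
      gcongr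
      exact natCast_mul_two_pow_le_exp d
    nlinarith
  rw [show (4 * w : ℝ) = 5 * w - w by ring]
  refine (abs_eval_sub_sub_eval_le (natDegree_hyperbolaSymm_le p _) interval_bound
    (hw0.trans_le hwh) grid_le ⟨hw0.le, hwh⟩).trans_eq ?_
  rw [hh]
  field_simp
  ring

theorem le_mul_exp_totalDegree {w N : ℤ} (hw : 0 < w) {p : MvPolynomial (Fin 2) ℝ}
    (hdw : p.totalDegree ≤ w) (h2 : 2 ≤ evalXY p (2 * w) (2 * w))
    (hL : ∀ x y : ℤ, ((x : ℝ), (y : ℝ)) ∈ regionL w N → |evalXY p x y| ≤ 1) :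
    (N : ℝ) ≤ 8 * w * Real.exp (6 * p.totalDegree) := by
  by_contra! hN
  have hw0 : (0 : ℝ) < w := Int.cast_pos.mpr hw
  have hwN : 4 * w ≤ N := by
    have := Real.one_le_exp (by positivity : (0 : ℝ) ≤ 6 * p.totalDegree)
    exact_mod_cast (by nlinarith : (4 * w : ℝ) ≤ N)
  linarith [two_le_hyperbolaSymm_eval_sub_eval hw.le hwN h2 hL,
    le_of_abs_le (abs_hyperbolaSymm_eval_sub_eval_le hw hdw hN.le hL)]

theorem evalXY_eq_of_totalDegree_eq_zero {p : MvPolynomial (Fin 2) ℝ} (hp : p.totalDegree = 0)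
    (x y x' y' : ℝ) : evalXY p x y = evalXY p x' y' := by
  rw [MvPolynomial.totalDegree_eq_zero_iff_eq_C.mp hp]
  simp only [evalXY, MvPolynomial.eval_C]

theorem le_mul_of_exp_mul_le {a b A x y : ℝ} (ha : 0 < a) (hA : 0 ≤ A) (hx : 0 ≤ x) (hy : 1 ≤ y)
    (h : Real.exp (a * x) ≤ A * x * Real.exp (b * y)) : x ≤ 2 / a * (2 * A / a + b) * y := by
  have linear_le_exp : A * x ≤ Real.exp (2 * A / a + a * x / 2) := by
    calc A * x = (2 * A / a) * (a * x / 2) := by field_simp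
      _ ≤ Real.exp (2 * A / a) * Real.exp (a * x / 2) := by
          gcongr <;> linarith [Real.add_one_le_exp (2 * A / a), Real.add_one_le_exp (a * x / 2)]
      _ = _ := (Real.exp_add _ _).symm
  have exponent_le : a * x ≤ 2 * A / a + a * x / 2 + b * y := by
    rw [← Real.exp_le_exp, Real.exp_add _ (b * y)]
    exact h.trans (by gcongr)
  have hA_le : 2 * A / a ≤ 2 * A / a * y := le_mul_of_one_le_right (by positivity) hy
  calc x = 2 / a * (a * x / 2) := by field_simp
    _ ≤ 2 / a * (2 * A / a * y + b * y) := by gcongr; linarith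
    _ = _ := by ring

theorem theorem3p3_general (c : ℝ) (hc : 0 < c) :
    ∃ δ : ℝ, 0 < δ ∧ ∀ w N : ℤ, 0 < w → 2 * w ≤ N → (2 : ℝ) ^ (c * (w : ℝ)) ≤ (N : ℝ) →
      ∀ p : MvPolynomial (Fin 2) ℝ,
        2 ≤ evalXY p (2 * (w : ℝ)) (2 * (w : ℝ)) →
        (∀ x y : ℤ, ((x : ℝ), (y : ℝ)) ∈ regionL (w : ℝ) (N : ℝ) →
          |evalXY p (x : ℝ) (y : ℝ)| ≤ 1) →
        δ * (w : ℝ) ≤ (p.totalDegree : ℝ) := by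
  set a := c * Real.log 2 with ha
  have ha0 : 0 < a := mul_pos hc (Real.log_pos one_lt_two)
  refine ⟨(1 + 2 / a * (2 * 8 / a + 6))⁻¹, by positivity, fun w N hw hwN hN p h2 hL => ?_⟩
  have hw0 : (0 : ℝ) ≤ w := Int.cast_nonneg hw.le
  rw [inv_mul_le_iff₀ (by positivity), add_mul, one_mul]
  obtain hdw | hwd := le_total (p.totalDegree : ℤ) w
  · have hd : 1 ≤ p.totalDegree := by
      refine Nat.one_le_iff_ne_zero.mpr fun hd => ?_
      have hle := hL (2 * w) 0 (.inl (intCast_mem_rectX.mpr ⟨⟨le_rfl, hwN⟩, le_rfl, hw.le⟩))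
      rw [evalXY_eq_of_totalDegree_eq_zero hd _ _ (2 * w) (2 * w)] at hle
      linarith [le_of_abs_le hle]
    have hexp : Real.exp (a * w) ≤ 8 * w * Real.exp (6 * p.totalDegree) := by
      refine (hN.trans_eq' ?_).trans (le_mul_exp_totalDegree hw hdw h2 hL)
      rw [Real.rpow_def_of_pos two_pos, ha]
      ring_nf
    have := le_mul_of_exp_mul_le ha0 (by norm_num) hw0 (Nat.one_le_cast.mpr hd) hexp
    linarith [(Nat.cast_nonneg p.totalDegree : (0 : ℝ) ≤ _)]
  · have hwd' : (w : ℝ) ≤ p.totalDegree := by exact_mod_cast hwd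
    exact hwd'.trans (le_add_of_nonneg_right (by positivity))

theorem theorem3p3 (c : ℝ) (hc : 0 < c) :
    ∃ δ : ℝ, 0 < δ ∧ ∀ w N : ℤ, 0 < w → 2 * w ≤ N → (2 : ℝ) ^ (c * (w : ℝ)) ≤ (N : ℝ) →
      ∀ p : MvPolynomial (Fin 2) ℝ,
        2 ≤ evalXY p (2 * (w : ℝ)) (2 * (w : ℝ)) →
        (∀ x y : ℤ, ((x : ℝ), (y : ℝ)) ∈ regionL (w : ℝ) (N : ℝ) →
          0 ≤ evalXY p (x : ℝ) (y : ℝ) ∧ evalXY p (x : ℝ) (y : ℝ) ≤ 1) →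
        δ * (w : ℝ) ≤ (p.totalDegree : ℝ) := by
  obtain ⟨δ, hδ, h⟩ := theorem3p3_general c hc
  exact ⟨δ, hδ, fun w N hw hwN hN p h2 hL => h w N hw hwN hN p h2 fun x y hxy =>
    abs_le.mpr ⟨by linarith [hL x y hxy], (hL x y hxy).2⟩⟩
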